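/- All topological spaces are assumed to be Hausdorff. A continuous mapping is *perfect* if it is closed, surjective, and all of its fibers are compact. A topological group $G$ is called - *feathered* if it contains a non-empty compact set $K$ of countable character in $G$, i.e. there is a countable family $\mathcal U$ of open sets containing $K$ such that every open set containing $K$ contains some $U\in\mathcal U$; - *$m$-factorizable* if for every continuous mapping $f:G\to M$ to a metrizable space $M$ there exist a continuous homomorphism $\pi:G\to K$ onto a second-countable topological group $K$ and a continuous mapping $g:K\to M$ such that $f=g\circ\pi$; - *$Pm$-factorizable* if for every continuous mapping $f:G\to M$ to a metrizable space $M$ there exist a perfect homomorphism $\pi:G\to K$ onto a second-countable topological group $K$ and a continuous mapping $g:K\to M$ such that $f=g\circ\pi$. **Corollary.** A topological group $G$ is $Pm$-factorizable if and only if $G$ is feathered and $m$-factorizable. -/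

import Mathlib

open Topology

universe u v

/-- A perfect mapping: a continuous closed surjection all of whose fibers are compact. -/
structure IsPerfectMap {X Y : Type*} [TopologicalSpace X] [TopologicalSpace Y]
    (f : X → Y) : Prop where
  continuous : Continuous f
  isClosedMap : IsClosedMap f
  surjective : Function.Surjective f
  isCompact_fiber : ∀ y : Y, IsCompact (f ⁻¹' {y})

/-- A topological group is feathered if it contains a non-empty compact set `K` of countable
character, that is, such that the neighborhoods of `K` have a countable base. -/
def IsFeathered (G : Type*) [TopologicalSpace G] : Prop :=
  ∃ K : Set G, K.Nonempty ∧ IsCompact K ∧ (𝓝ˢ K).IsCountablyGenerated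

/-- A topological group `G` is m-factorizable if every continuous mapping `f` of `G` to a
metrizable space `M` is the composition of a continuous homomorphism of `G` onto a
second-countable Hausdorff topological group `K` and a continuous mapping of `K` to `M`.
Being an image of `G`, the group `K` may be taken in the universe of `G`; the universe of `M`
is arbitrary. -/
def IsmFactorizable (G : Type u) [Group G] [TopologicalSpace G] : Prop :=
  ∀ (M : Type v) [TopologicalSpace M] [TopologicalSpace.MetrizableSpace M] (f : G → M),
    Continuous f →
    ∃ (K : Type u) (_ : Group K) (_ : TopologicalSpace K) (_ : IsTopologicalGroup K)
      (_ : T2Space K) (_ : SecondCountableTopology K) (π : G →* K) (g : K → M),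
      Continuous π ∧ Function.Surjective π ∧ Continuous g ∧ f = g ∘ π

/-- A topological group `G` is Pm-factorizable if every continuous mapping `f` of `G` to a
metrizable space `M` is the composition of a perfect homomorphism of `G` onto a
second-countable Hausdorff topological group `K` and a continuous mapping of `K` to `M`. -/
def IsPmFactorizable (G : Type u) [Group G] [TopologicalSpace G] : Prop :=
  ∀ (M : Type v) [TopologicalSpace M] [TopologicalSpace.MetrizableSpace M] (f : G → M),
    Continuous f →
    ∃ (K : Type u) (_ : Group K) (_ : TopologicalSpace K) (_ : IsTopologicalGroup K)
      (_ : T2Space K) (_ : SecondCountableTopology K) (π : G →* K) (g : K → M),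
      IsPerfectMap π ∧ Continuous g ∧ f = g ∘ π

open Filter Set

/-! For the hard direction, let `C` be compact of countable character and `a ∈ C`. Complete
regularity gives a continuous `φ : G → ℝ^ℕ` near whose value at `a` all preimages shrink into
neighborhoods of `C`. Factoring the pair `(f, φ)` instead of `f` passes this property to `π` at `a`;
translations carry it to every point, so `π` is proper. Conversely, a fiber of a perfect map onto a
first-countable space is compact of countable character. -/

/-- An ultrafilter that is finer than the neighborhood filter of a compact set converges to a point
of this set. -/
theorem IsCompact.exists_ultrafilter_le_nhds_of_le_nhdsSet {X : Type*} [TopologicalSpace X]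
    {K : Set X} (hK : IsCompact K) {𝒰 : Ultrafilter X} (h : (𝒰 : Filter X) ≤ 𝓝ˢ K) :
    ∃ x ∈ K, (𝒰 : Filter X) ≤ 𝓝 x := by
  by_contra! hne
  have hdisj : Disjoint (𝓝ˢ K) (𝒰 : Filter X) :=
    hK.disjoint_nhdsSet_left.2 fun x hx => (Ultrafilter.disjoint_iff_not_le.2 (hne x hx)).symm
  exact 𝒰.neBot.ne (disjoint_self.1 (hdisj.mono_left h))

/-- A continuous homomorphism of topological groups is a proper map as soon as it is surjective and
the preimages of the neighborhoods of one point of its codomain form a filter finer than the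
neighborhood filter of a compact set. -/
theorem MonoidHom.isProperMap_of_comap_nhds_le_nhdsSet {G H : Type*} [Group G] [TopologicalSpace G]
    [IsTopologicalGroup G] [Group H] [TopologicalSpace H] [IsTopologicalGroup H] [T2Space H]
    {π : G →* H} (hπ : Continuous π) (hsurj : Function.Surjective π) {K : Set G}
    (hK : IsCompact K) {a : G} (h : comap π (𝓝 (π a)) ≤ 𝓝ˢ K) : IsProperMap π := by
  refine isProperMap_iff_ultrafilter_of_t2.2 ⟨hπ, fun 𝒰 y hy => ?_⟩
  obtain ⟨x, rfl⟩ := hsurj y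
  -- Left translation by `a * x⁻¹` moves the limit from `π x` to `π a`, where `K` gives control;
  -- `hback` undoes it.
  have hshift : Tendsto π (𝒰.map (a * x⁻¹ * ·)) (𝓝 (π a)) := by
    have hmul : Tendsto (fun z => π (a * x⁻¹) * π z) 𝒰 (𝓝 (π (a * x⁻¹) * π x)) :=
      hy.const_mul _
    rw [← map_mul, inv_mul_cancel_right] at hmul
    simpa [Function.comp_def, tendsto_map'_iff] using hmul
  obtain ⟨z, -, hz⟩ :=
    hK.exists_ultrafilter_le_nhds_of_le_nhdsSet ((tendsto_iff_comap.1 hshift).trans h)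
  refine ⟨x * a⁻¹ * z, ?_⟩
  have hback : Tendsto (fun w => x * a⁻¹ * (a * x⁻¹ * w)) 𝒰 (𝓝 (x * a⁻¹ * z)) :=
    Tendsto.const_mul _ hz
  simpa [mul_assoc, Tendsto] using hback

theorem IsProperMap.isPerfectMap {X Y : Type*} [TopologicalSpace X] [TopologicalSpace Y]
    [T1Space Y] {f : X → Y} (hf : IsProperMap f) (hsurj : Function.Surjective f) :
    IsPerfectMap f :=
  ⟨hf.continuous, hf.isClosedMap, hsurj, fun _ => hf.isCompact_preimage isCompact_singleton⟩

theorem IsPerfectMap.isFeathered {X Y : Type*} [TopologicalSpace X] [TopologicalSpace Y]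
    [FirstCountableTopology Y] [Nonempty Y] {f : X → Y} (hf : IsPerfectMap f) :
    IsFeathered X := by
  obtain ⟨y⟩ := ‹Nonempty Y›
  obtain ⟨x, rfl⟩ := hf.surjective y
  refine ⟨f ⁻¹' {f x}, ⟨x, rfl⟩, hf.isCompact_fiber _, ?_⟩
  -- Closedness makes preimages of neighborhoods of `f x` a base at the fiber.
  rw [← hf.isClosedMap.comap_nhdsSet_eq hf.continuous, nhdsSet_singleton]
  infer_instance

theorem IsPmFactorizable.ismFactorizable {G : Type u} [Group G] [TopologicalSpace G]
    (h : IsPmFactorizable.{u, v} G) : IsmFactorizable.{u, v} G := fun M _ _ f hf =>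
  let ⟨K, i₁, i₂, i₃, i₄, i₅, π, g, hπ, hg, hfg⟩ := h M f hf
  ⟨K, i₁, i₂, i₃, i₄, i₅, π, g, hπ.continuous, hπ.surjective, hg, hfg⟩

theorem IsPmFactorizable.isFeathered {G : Type u} [Group G] [TopologicalSpace G]
    (h : IsPmFactorizable.{u, v} G) : IsFeathered G := by
  obtain ⟨K, _, _, _, _, _, π, _, hπ, -, -⟩ :=
    h PUnit.{v + 1} (fun _ => PUnit.unit) continuous_const
  exact hπ.isFeathered

/-- In a completely regular space, every point of a set of countable character admits a continuous
map to a metrizable space that recovers the neighborhood filter of the set. -/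
theorem exists_continuous_comap_nhds_le_nhdsSet {X : Type*} [TopologicalSpace X]
    [CompletelyRegularSpace X] {K : Set X} [(𝓝ˢ K).IsCountablyGenerated] {a : X} (ha : a ∈ K) :
    ∃ φ : X → ℕ → ℝ, Continuous φ ∧ comap φ (𝓝 (φ a)) ≤ 𝓝ˢ K := by
  obtain ⟨U, hU⟩ := (𝓝ˢ K).exists_antitone_basis
  have hsep : ∀ n, ∃ f : X → unitInterval, Continuous f ∧ f a = 0 ∧
      EqOn f 1 (interior (U n))ᶜ := fun n =>
    CompletelyRegularSpace.completely_regular a _ isOpen_interior.isClosed_compl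
      fun h => h (subset_interior_iff_mem_nhdsSet.2 (hU.mem n) ha)
  choose f hf hfa hf1 using hsep
  refine ⟨fun x n => f n x, by fun_prop, hU.toHasBasis.ge_iff.2 fun n _ => ?_⟩
  refine mem_comap.2 ⟨{p | p n < 1}, ?_, fun x hx => ?_⟩
  · exact (isOpen_lt (continuous_apply n) continuous_const).mem_nhds (by simp [hfa])
  · by_contra hxU
    have : f n x = 1 := hf1 n fun h => hxU (interior_subset h)
    simp [this] at hx

theorem IsmFactorizable.isPmFactorizable {G : Type u} [Group G] [TopologicalSpace G]
    [IsTopologicalGroup G] (hm : IsmFactorizable.{u, v} G) (hG : IsFeathered G) :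
    IsPmFactorizable.{u, v} G := by
  obtain ⟨C, ⟨a, ha⟩, hC, _⟩ := hG
  have : CompletelyRegularSpace G :=
    .of_exists_uniformSpace ⟨IsTopologicalGroup.rightUniformSpace G, rfl⟩
  obtain ⟨φ, hφ, hφC⟩ := exists_continuous_comap_nhds_le_nhdsSet ha
  intro M _ _ f hf
  obtain ⟨K, _, _, _, _, _, π, g, hπ, hsurj, hg, hfg⟩ :=
    -- `ULift` puts the target in the universe of `M`.
    hm (M × (ℕ → ULift.{v} ℝ)) (fun x => (f x, fun n => ULift.up (φ x n))) (by fun_prop)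
  have hφπ : φ = (fun k n => ((g k).2 n).down) ∘ π := by
    funext x n
    exact congrArg (fun p => (p.2 n).down) (congrFun hfg x)
  have hφg : Continuous fun k n => ((g k).2 n).down :=
    continuous_pi fun n => continuous_uliftDown.comp ((continuous_apply n).comp hg.snd)
  have hle : comap π (𝓝 (π a)) ≤ 𝓝ˢ C := by
    refine le_trans ?_ hφC
    rw [hφπ, ← comap_comap]
    exact comap_mono (hφg.tendsto _).le_comap
  refine ⟨K, _, _, ‹_›, ‹_›, ‹_›, π, fun k => (g k).1,
    (π.isProperMap_of_comap_nhds_le_nhdsSet hπ hsurj hC hle).isPerfectMap hsurj, hg.fst, ?_⟩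
  funext x
  exact congrArg Prod.fst (congrFun hfg x)

theorem corollary5p5 (G : Type u) [Group G] [TopologicalSpace G] [IsTopologicalGroup G]
    [T2Space G] :
    IsPmFactorizable.{u, v} G ↔ IsFeathered G ∧ IsmFactorizable.{u, v} G :=
  ⟨fun h => ⟨h.isFeathered, h.ismFactorizable⟩, fun h => h.2.isPmFactorizable h.1⟩
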